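/- Let $R$ be a Noetherian commutative ring of finite Krull dimension $d \ge 0$ whose spectrum (set of prime ideals) is at most countable, and put $$\mu(d) = d + (d-2) + (d-4) + \dotsb = \sum_{i\ge 0,\ 2i \le d} (d-2i).$$ Then there exists a collection of $m=\mu(d)$ at most countable multiplicative subsets $S_1,\dots,S_m \subset R$ such that every flat $R$-module is $\mathbf{S}^\times$-strongly flat for $\mathbf{S}=\{S_1,\dots,S_m\}$. Here a multiplicative subset contains $1$ and is closed under multiplication. For a subset $J\subset\{1,\dots,m\}$, let $S_J\subset R$ denote the multiplicative subset generated by all the $S_j$, $j\in J$ (so $S_\varnothing=\{1\}$), and let $\mathbf{S}^\times=\{S_J \mid J\subset\{1,\dots,m\}\}$. An $R$-module $C$ is called $\mathbf{S}^\times$-weakly cotorsion if $\operatorname{Ext}^1_R(S_J^{-1}R,C)=0$ for all $J\subset\{1,\dots,m\}$, and an $R$-module $F$ is called $\mathbf{S}^\times$-strongly flat if $\operatorname{Ext}^1_R(F,C)=0$ for all $\mathbf{S}^\times$-weakly cotorsion $R$-modules $C$. -/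

import Mathlib

open CategoryTheory

universe u

namespace StronglyFlat

section Modules

variable {R : Type u} [CommRing R]

/-- A module `C` is weakly cotorsion with respect to a collection of multiplicative subsets
`S i` of `R` if `Ext¹_R((S i)⁻¹R, C) = 0` for all `i`. -/
def IsWeaklyCotorsion {ι : Type*} (S : ι → Submonoid R)
    (C : Type u) [AddCommGroup C] [Module R C] : Prop :=
  ∀ i : ι, Subsingleton
    (Abelian.Ext (ModuleCat.of R (Localization (S i))) (ModuleCat.of R C) 1)

/-- A module `F` is strongly flat with respect to a collection of multiplicative subsets
of `R` if `Ext¹_R(F, C) = 0` for all modules `C` that are weakly cotorsion with respect to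
this collection. -/
def IsStronglyFlat {ι : Type*} (S : ι → Submonoid R)
    (F : Type u) [AddCommGroup F] [Module R F] : Prop :=
  ∀ (C : Type u) [AddCommGroup C] [Module R C], IsWeaklyCotorsion S C →
    Subsingleton (Abelian.Ext (ModuleCat.of R F) (ModuleCat.of R C) 1)

/-- For a collection of multiplicative subsets `S j`, the collection `S^×` of the
multiplicative subsets `S_J` generated by the union of the `S j`, `j ∈ J`, where `J` runs over
all the subsets of the index set. -/
def timesFamily {ι : Type*} (S : ι → Submonoid R) : Set ι → Submonoid R :=
  fun J => ⨆ j ∈ J, S j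

end Modules

/-- `mu d = d + (d - 2) + (d - 4) + ⋯`, the sum of `d - 2 * i` over all `i` with
`0 ≤ 2 * i ≤ d`. -/
def mu (d : ℕ) : ℕ :=
  ∑ i ∈ Finset.range (d / 2 + 1), (d - 2 * i)

end StronglyFlat

/-! It suffices to choose the `S j` so that any two primes `p < q` are separated by one of them,
i.e. some `S j` meets `q` but not `p`; weakly cotorsion modules for `S^×` are then cotorsion.

The homological half (`isCotorsion_of_separatedBy`) is an induction on the list of separating sets,
over all Noetherian `R`-algebras `B` and `B`-modules `C`. With no sets left, `B` is Artinian and all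
its modules are cotorsion. Otherwise the first set `S` is no longer needed over `B/tB` (`t ∈ S`) nor
over `S⁻¹B`. The first ring makes `Ext¹(F, C)` divisible by `S`; the second, through `Hom(S⁻¹R, C)`,
gives `Ext¹(S⁻¹F, C) = 0`. As `S` is countable, `S⁻¹F` is the cokernel of an injective telescope map
on `F^(ℕ)`, and the two facts force `Ext¹(F, C) = 0`.

The combinatorial half (`exists_separating`) builds, by prime avoidance along an enumeration of the
spectrum, `e` countable sets such that every prime meets at most as many of them as its height, with
equality in heights `e - 1` and `e`. These separate `p < q` whenever `q` has such a height. Taking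
`e = d, d - 2, …` exhausts all heights at the cost of `mu d` sets. -/

namespace StronglyFlat

/-! ### Vanishing of `Ext¹` as extension and lifting of maps. -/

section ExtVanishing

open Abelian

variable {R : Type u} [CommRing R]

/-- Vanishing of `Ext¹_R(M, N)`. -/
abbrev ExtVanishes (R : Type u) [CommRing R] (M N : Type u) [AddCommGroup M] [Module R M]
    [AddCommGroup N] [Module R N] : Prop :=
  Subsingleton (Ext (ModuleCat.of R M) (ModuleCat.of R N) 1)

variable {M N P K : Type u} [AddCommGroup M] [Module R M] [AddCommGroup N] [Module R N]
  [AddCommGroup P] [Module R P] [AddCommGroup K] [Module R K]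

theorem shortExact_of_exact {i : K →ₗ[R] P} {p : P →ₗ[R] M} (hi : Function.Injective i)
    (hp : Function.Surjective p) (h : Function.Exact i p) :
    (ModuleCat.shortComplexOfCompEqZero i p h.linearMap_comp_eq_zero).ShortExact :=
  ModuleCat.shortComplex_shortExact _ h hi hp

theorem ExtVanishes.of_projective [Module.Projective R P] : ExtVanishes R P N := by
  have : Projective (ModuleCat.of R P) := (IsProjective.iff_projective P).1 inferInstance
  exact Ext.subsingleton_of_projective _ _ 0

theorem ExtVanishes.exists_extend {i : K →ₗ[R] P} {p : P →ₗ[R] M} (hi : Function.Injective i)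
    (hp : Function.Surjective p) (h : Function.Exact i p) (hv : ExtVanishes R M N)
    (f : K →ₗ[R] N) : ∃ g : P →ₗ[R] N, g ∘ₗ i = f := by
  have hS := shortExact_of_exact hi hp h
  obtain ⟨x, hx⟩ := Ext.contravariant_sequence_exact₁ hS (ModuleCat.of R N)
    (Ext.mk₀ (ModuleCat.ofHom f)) (add_zero 1) (hv.elim _ _)
  obtain ⟨g, rfl⟩ := Ext.addEquiv₀.symm.surjective x
  refine ⟨g.hom, ?_⟩
  simp only [Ext.addEquiv₀_symm_apply, Ext.mk₀_comp_mk₀] at hx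
  have := Ext.addEquiv₀.symm.injective hx
  exact congrArg ModuleCat.Hom.hom this

theorem ExtVanishes.of_extend {i : K →ₗ[R] P} {p : P →ₗ[R] M} (hi : Function.Injective i)
    (hp : Function.Surjective p) (h : Function.Exact i p) (hv : ExtVanishes R P N)
    (H : ∀ f : K →ₗ[R] N, ∃ g : P →ₗ[R] N, g ∘ₗ i = f) : ExtVanishes R M N := by
  have hS := shortExact_of_exact hi hp h
  refine subsingleton_of_forall_eq 0 fun x => ?_
  obtain ⟨y, rfl⟩ := Ext.contravariant_sequence_exact₃ hS (ModuleCat.of R N) x (hv.elim _ _)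
    (add_zero 1)
  obtain ⟨f, rfl⟩ := Ext.addEquiv₀.symm.surjective y
  obtain ⟨g, hg⟩ := H f.hom
  have : f = (ModuleCat.shortComplexOfCompEqZero i p h.linearMap_comp_eq_zero).f ≫
      ModuleCat.ofHom g := by
    ext x; exact (LinearMap.congr_fun hg x).symm
  rw [this]
  simp only [Ext.addEquiv₀_symm_apply]
  rw [← Ext.mk₀_comp_mk₀, hS.extClass_comp_assoc]

theorem ExtVanishes.exists_lift {i : K →ₗ[R] P} {p : P →ₗ[R] M} (hi : Function.Injective i)
    (hp : Function.Surjective p) (h : Function.Exact i p) (hv : ExtVanishes R N K)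
    (f : N →ₗ[R] M) : ∃ g : N →ₗ[R] P, p ∘ₗ g = f := by
  have hS := shortExact_of_exact hi hp h
  obtain ⟨x, hx⟩ := Ext.covariant_sequence_exact₃ (ModuleCat.of R N) hS
    (Ext.mk₀ (ModuleCat.ofHom f)) (zero_add 1) (hv.elim _ _)
  obtain ⟨g, rfl⟩ := Ext.addEquiv₀.symm.surjective x
  refine ⟨g.hom, ?_⟩
  simp only [Ext.addEquiv₀_symm_apply, Ext.mk₀_comp_mk₀] at hx
  have := Ext.addEquiv₀.symm.injective hx
  exact congrArg ModuleCat.Hom.hom this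

theorem ExtVanishes.of_lift {i : K →ₗ[R] P} {p : P →ₗ[R] M} (hi : Function.Injective i)
    (hp : Function.Surjective p) (h : Function.Exact i p) (hv : ExtVanishes R N P)
    (H : ∀ f : N →ₗ[R] M, ∃ g : N →ₗ[R] P, p ∘ₗ g = f) : ExtVanishes R N K := by
  have hS := shortExact_of_exact hi hp h
  refine subsingleton_of_forall_eq 0 fun x => ?_
  obtain ⟨y, rfl⟩ := Ext.covariant_sequence_exact₁ (ModuleCat.of R N) hS x (hv.elim _ _)
    (zero_add 1)
  obtain ⟨f, rfl⟩ := Ext.addEquiv₀.symm.surjective y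
  obtain ⟨g, hg⟩ := H f.hom
  have : f = ModuleCat.ofHom g ≫
      (ModuleCat.shortComplexOfCompEqZero i p h.linearMap_comp_eq_zero).g := by
    ext x; exact (LinearMap.congr_fun hg x).symm
  rw [this]
  simp only [Ext.addEquiv₀_symm_apply]
  rw [← Ext.mk₀_comp_mk₀, Ext.comp_assoc_of_second_deg_zero, hS.comp_extClass, Ext.comp_zero]

theorem ExtVanishes.of_exact {i : K →ₗ[R] P} {p : P →ₗ[R] M} (hi : Function.Injective i)
    (hp : Function.Surjective p) (h : Function.Exact i p) (hK : ExtVanishes R N K)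
    (hM : ExtVanishes R N M) : ExtVanishes R N P := by
  have hS := shortExact_of_exact hi hp h
  refine subsingleton_of_forall_eq 0 fun x => ?_
  obtain ⟨y, rfl⟩ := Ext.covariant_sequence_exact₂ (ModuleCat.of R N) hS x (hM.elim _ _)
  rw [(hK.elim y 0 : y = 0), Ext.zero_comp]

theorem ExtVanishes.congr_left (e : M ≃ₗ[R] P) (h : ExtVanishes R M N) : ExtVanishes R P N := by
  refine subsingleton_of_forall_eq 0 fun x => ?_
  have : x = (Ext.mk₀ e.toModuleIso.inv).comp
      ((Ext.mk₀ e.toModuleIso.hom).comp x (zero_add 1)) (zero_add 1) := by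
    rw [Ext.mk₀_comp_mk₀_assoc, Iso.inv_hom_id, Ext.mk₀_id_comp]
  rw [this, h.elim (Ext.comp _ x _) 0, Ext.comp_zero]

end ExtVanishing

/-! ### Countable localizations as telescopes. -/

section Telescope

variable {R : Type u} [CommRing R] {M N : Type u} [AddCommGroup M] [Module R M]
  [AddCommGroup N] [Module R N]

/-- The map `M^(ℕ) → M^(ℕ)` whose cokernel is the direct limit of `M → M → M → ⋯`, the `n`-th map
being the multiplication by `s n`. -/
noncomputable def telescope (s : ℕ → R) (M : Type u) [AddCommGroup M] [Module R M] :
    (ℕ →₀ M) →ₗ[R] (ℕ →₀ M) :=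
  Finsupp.lsum R fun n => Finsupp.lsingle n - s n • Finsupp.lsingle (n + 1)

@[simp]
theorem telescope_single (s : ℕ → R) (n : ℕ) (x : M) :
    telescope s M (Finsupp.single n x) = Finsupp.single n x - Finsupp.single (n + 1) (s n • x) := by
  simp [telescope]

theorem telescope_apply_zero (s : ℕ → R) (x : ℕ →₀ M) : telescope s M x 0 = x 0 := by
  induction x using Finsupp.induction_linear with
  | zero => simp
  | add x y hx hy => simp [hx, hy]
  | single n m => simp

theorem telescope_apply_succ (s : ℕ → R) (x : ℕ →₀ M) (n : ℕ) :
    telescope s M x (n + 1) = x (n + 1) - s n • x n := by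
  induction x using Finsupp.induction_linear with
  | zero => simp
  | add x y hx hy => simp only [map_add, Finsupp.add_apply, hx, hy, smul_add]; abel
  | single k m =>
    rcases eq_or_ne k n with rfl | h
    · simp
    · simp [Finsupp.single_apply, h]

theorem telescope_injective (s : ℕ → R) : Function.Injective (telescope s M) := by
  rw [injective_iff_map_eq_zero]
  intro x hx
  ext n
  induction n with
  | zero => rw [← telescope_apply_zero s, hx]
  | succ n ih =>
    have := telescope_apply_succ s x n
    rw [hx, ih] at this
    simpa using this.symm

theorem telescope_comp_mapRange (s : ℕ → R) (f : M →ₗ[R] N) :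
    telescope s N ∘ₗ Finsupp.mapRange.linearMap f =
      Finsupp.mapRange.linearMap f ∘ₗ telescope s M := by
  ext n x : 2
  simp [Finsupp.mapRange_sub]

theorem single_sub_single_mem_range_telescope (s : ℕ → R) {n k : ℕ} (h : n ≤ k) (x : M) :
    Finsupp.single n x - Finsupp.single k ((∏ i ∈ Finset.Ico n k, s i) • x) ∈
      LinearMap.range (telescope s M) := by
  induction k, h using Nat.le_induction with
  | base => simp
  | succ k hk ih =>
    have : Finsupp.single n x - Finsupp.single (k + 1) ((∏ i ∈ Finset.Ico n (k + 1), s i) • x) =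
        (Finsupp.single n x - Finsupp.single k ((∏ i ∈ Finset.Ico n k, s i) • x)) +
        telescope s M (Finsupp.single k ((∏ i ∈ Finset.Ico n k, s i) • x)) := by
      rw [telescope_single, Finset.prod_Ico_succ_top hk, mul_comm, mul_smul]
      abel
    rw [this]
    exact add_mem ih ⟨_, rfl⟩

theorem exists_sub_single_mem_range_telescope (s : ℕ → R) (x : ℕ →₀ M) :
    ∃ n, ∀ k ≥ n, ∃ y, x - Finsupp.single k y ∈ LinearMap.range (telescope s M) := by
  induction x using Finsupp.induction_linear with
  | zero => exact ⟨0, fun k _ => ⟨0, by simp⟩⟩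
  | add x y hx hy =>
    obtain ⟨n, hn⟩ := hx
    obtain ⟨m, hm⟩ := hy
    refine ⟨max n m, fun k hk => ?_⟩
    obtain ⟨a, ha⟩ := hn k (le_trans (le_max_left _ _) hk)
    obtain ⟨b, hb⟩ := hm k (le_trans (le_max_right _ _) hk)
    refine ⟨a + b, ?_⟩
    rw [Finsupp.single_add, add_sub_add_comm]
    exact add_mem ha hb
  | single n m => exact ⟨n, fun k hk => ⟨_, single_sub_single_mem_range_telescope s hk m⟩⟩

/-- Infinite recurrence puts every element of `S` among the factors of every tail of the sequence,
so the colimit along it inverts, and kills the torsion of, all of `S`. -/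
theorem exists_seq_frequently_eq {S : Submonoid R} (hS : (S : Set R).Countable) :
    ∃ s : ℕ → S, ∀ u : S, ∀ n, ∃ k ≥ n, s k = u := by
  have := hS.to_subtype
  obtain ⟨f, hf⟩ := exists_surjective_nat S
  refine ⟨fun n => f n.unpair.1, fun u n => ?_⟩
  obtain ⟨i, rfl⟩ := hf u
  exact ⟨Nat.pair i n, Nat.right_le_pair i n, by simp⟩

/-- The map `M^(ℕ) → S⁻¹M` given on the `n`-th summand by the division by
`s 0 * ⋯ * s (n - 1)`. -/
noncomputable def telescopeTo {S : Submonoid R} (s : ℕ → S) (f : M →ₗ[R] N)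
    [IsLocalizedModule S f] : (ℕ →₀ M) →ₗ[R] N :=
  Finsupp.lsum R fun n =>
    { toFun := fun x => IsLocalizedModule.mk' f x (∏ i ∈ Finset.range n, s i)
      map_add' := fun x y => IsLocalizedModule.mk'_add f x y _
      map_smul' := fun r x => IsLocalizedModule.mk'_smul f r x _ }

@[simp]
theorem telescopeTo_single {S : Submonoid R} (s : ℕ → S) (f : M →ₗ[R] N)
    [IsLocalizedModule S f] (n : ℕ) (x : M) : telescopeTo s f (Finsupp.single n x) =
      IsLocalizedModule.mk' f x (∏ i ∈ Finset.range n, s i) := by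
  simp [telescopeTo]

theorem telescopeTo_surjective {S : Submonoid R} {s : ℕ → S}
    (hs : ∀ u : S, ∀ n, ∃ k ≥ n, s k = u) (f : M →ₗ[R] N) [IsLocalizedModule S f] :
    Function.Surjective (telescopeTo s f) := by
  intro y
  obtain ⟨⟨x, u⟩, rfl⟩ := IsLocalizedModule.mk'_surjective S f y
  obtain ⟨k, -, rfl⟩ := hs u 0
  -- The denominator at index `k + 1` is `s 0 ⋯ s k`; all its factors except `s k = u` are cancelled
  -- by the numerator.
  refine ⟨Finsupp.single (k + 1) ((∏ i ∈ Finset.range k, s i) • x), ?_⟩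
  rw [telescopeTo_single, Finset.prod_range_succ, IsLocalizedModule.mk'_cancel_left]
  rfl

theorem telescope_exact {S : Submonoid R} {s : ℕ → S}
    (hs : ∀ u : S, ∀ n, ∃ k ≥ n, s k = u) (f : M →ₗ[R] N) [IsLocalizedModule S f] :
    Function.Exact (telescope (fun n => (s n : R)) M) (telescopeTo s f) := by
  have h0 : telescopeTo s f ∘ₗ telescope (fun n => (s n : R)) M = 0 := by
    ext n x
    simp only [LinearMap.coe_comp, Function.comp_apply, Finsupp.lsingle_apply, telescope_single,
      map_sub, telescopeTo_single, Finset.prod_range_succ, LinearMap.zero_apply]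
    rw [show (s n : R) • x = s n • x from rfl, IsLocalizedModule.mk'_cancel_right, sub_self]
  refine LinearMap.exact_iff.2 (le_antisymm (fun x hx => ?_) (LinearMap.range_le_ker_iff.2 h0))
  obtain ⟨n, hn⟩ := exists_sub_single_mem_range_telescope (fun n => (s n : R)) x
  obtain ⟨y, hy⟩ := hn n le_rfl
  have hy0 : telescopeTo s f (Finsupp.single n y) = 0 := by
    have := LinearMap.range_le_ker_iff.2 h0 hy
    rw [LinearMap.mem_ker, map_sub, (hx : telescopeTo s f x = 0), zero_sub, neg_eq_zero] at this
    exact this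
  rw [telescopeTo_single, IsLocalizedModule.mk'_eq_zero'] at hy0
  obtain ⟨u, hu⟩ := hy0
  -- The annihilator `u` of `y` recurs at some `k ≥ n`, so moving `y` from index `n` to `k + 1`
  -- turns it into zero.
  obtain ⟨k, hk, rfl⟩ := hs u n
  have h1 := single_sub_single_mem_range_telescope (fun n => (s n : R))
    (show n ≤ k + 1 by omega) y
  have h2 : (s k : R) • y = 0 := hu
  rw [Finset.prod_Ico_succ_top hk, mul_smul, h2, smul_zero, Finsupp.single_zero, sub_zero] at h1
  simpa using add_mem hy h1

end Telescope

/-! ### Inheritance of `Ext¹` vanishing: quotients, sums, tensor products, ladders. -/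

section Vanishing

variable {R : Type u} [CommRing R] {M N P K C : Type u} [AddCommGroup M] [Module R M]
  [AddCommGroup N] [Module R N] [AddCommGroup P] [Module R P] [AddCommGroup K] [Module R K]
  [AddCommGroup C] [Module R C]

/-- If `S` is countable, the localization at `S` has projective dimension at most one, so that the
vanishing of `Ext¹_R(S⁻¹R, -)` is inherited by the quotients. -/
theorem ExtVanishes.localization_of_surjective {S : Submonoid R} (hS : (S : Set R).Countable)
    {p : N →ₗ[R] M} (hp : Function.Surjective p) (h : ExtVanishes R (Localization S) N) :
    ExtVanishes R (Localization S) M := by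
  obtain ⟨s, hs⟩ := exists_seq_frequently_eq hS
  have hi := telescope_injective (M := R) fun n => (s n : R)
  have hsurj := telescopeTo_surjective hs (Algebra.linearMap R (Localization S))
  have hex := telescope_exact hs (Algebra.linearMap R (Localization S))
  refine .of_extend hi hsurj hex .of_projective fun f => ?_
  -- The telescope is a free resolution of length one, so a cocycle with values in `M` lifts to `N`,
  -- where it is trivial.
  obtain ⟨f', rfl⟩ := Module.projective_lifting_property p f hp
  obtain ⟨g, hg⟩ := h.exists_extend hi hsurj hex f'
  exact ⟨p ∘ₗ g, by rw [LinearMap.comp_assoc, hg]⟩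

theorem exists_free_presentation (R : Type u) [CommRing R] (M : Type u) [AddCommGroup M]
    [Module R M] : ∃ (K : Type u) (_ : AddCommGroup K) (_ : Module R K) (i : K →ₗ[R] (M →₀ R))
      (p : (M →₀ R) →ₗ[R] M), Function.Injective i ∧ Function.Surjective p ∧
        Function.Exact i p :=
  ⟨LinearMap.ker (Finsupp.linearCombination R (id : M → M)), inferInstance, inferInstance,
    Submodule.subtype _, Finsupp.linearCombination R id, Subtype.val_injective,
    Finsupp.linearCombination_id_surjective R M, LinearMap.exact_subtype_ker_map _⟩

theorem mapRange_exact {ι : Type*} {i : K →ₗ[R] P} {p : P →ₗ[R] M} (h : Function.Exact i p) :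
    Function.Exact (Finsupp.mapRange.linearMap (α := ι) i) (Finsupp.mapRange.linearMap p) := by
  refine LinearMap.exact_iff.2 (le_antisymm (fun x hx => ?_) ?_)
  · rw [← x.sum_single]
    refine Submodule.sum_mem _ fun j _ => ?_
    obtain ⟨k, hk⟩ := (h (x j)).1 (by simpa using DFunLike.congr_fun hx j)
    exact ⟨Finsupp.single j k, by simp [hk]⟩
  · rw [LinearMap.range_le_ker_iff]
    ext j x
    simp [h.apply_apply_eq_zero]

theorem ExtVanishes.finsupp (ι : Type u) (h : ExtVanishes R M C) : ExtVanishes R (ι →₀ M) C := by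
  obtain ⟨K, _, _, i, p, hi, hp, hex⟩ := exists_free_presentation R M
  refine .of_extend (K := ι →₀ K) (P := ι →₀ M →₀ R)
    (i := Finsupp.mapRange.linearMap i)
    (p := Finsupp.mapRange.linearMap p) (Finsupp.mapRange_injective i (map_zero i) hi)
    (Finsupp.mapRange_surjective _ (map_zero p) hp) (mapRange_exact (ι := ι) hex) .of_projective
    fun f => ?_
  choose g hg using fun j => h.exists_extend hi hp hex (f ∘ₗ Finsupp.lsingle j)
  refine ⟨Finsupp.lsum R g, ?_⟩
  ext j x
  simpa using LinearMap.congr_fun (hg j) x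

/-- If `Ext¹_R(A, C) = 0` for a flat module `A`, then the vanishing of `Ext¹_R(M, Hom_R(A, C))`
implies that of `Ext¹_R(M ⊗ A, C)`. -/
theorem ExtVanishes.tensor {A : Type u} [AddCommGroup A] [Module R A] [Module.Flat R A]
    (hA : ExtVanishes R A C) (h : ExtVanishes R M (A →ₗ[R] C)) :
    ExtVanishes R (TensorProduct R M A) C := by
  obtain ⟨K, _, _, i, p, hi, hp, hex⟩ := exists_free_presentation R M
  classical
  refine .of_extend (i := i.rTensor A) (p := p.rTensor A)
    (Module.Flat.rTensor_preserves_injective_linearMap i hi)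
    (LinearMap.rTensor_surjective A hp) (rTensor_exact A hex hp)
    ((hA.finsupp M).congr_left (P := TensorProduct R (M →₀ R) A)
      (TensorProduct.finsuppScalarLeft R A M).symm) fun f => ?_
  obtain ⟨g, hg⟩ := h.exists_extend hi hp hex (TensorProduct.curry f)
  refine ⟨TensorProduct.lift g, ?_⟩
  ext x a
  simpa using LinearMap.congr_fun (LinearMap.congr_fun hg x) a

/-- Tensoring a presentation with the flat `A` keeps it exact, and extension problems into `Hom(A,
C)` are uncurried. Unlike in `ExtVanishes.tensor`, no vanishing of `Ext¹(A, C)` is needed. -/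
theorem ExtVanishes.of_tensor {A : Type u} [AddCommGroup A] [Module R A] [Module.Flat R A]
    (h : ExtVanishes R (TensorProduct R M A) C) : ExtVanishes R M (A →ₗ[R] C) := by
  obtain ⟨K, _, _, i, p, hi, hp, hex⟩ := exists_free_presentation R M
  refine .of_extend hi hp hex .of_projective fun f => ?_
  obtain ⟨g, hg⟩ := h.exists_extend
    (Module.Flat.rTensor_preserves_injective_linearMap (M := A) i hi)
    (LinearMap.rTensor_surjective A hp) (rTensor_exact A hex hp) (TensorProduct.lift f)
  refine ⟨TensorProduct.curry g, ?_⟩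
  ext x a
  simpa using LinearMap.congr_fun hg (x ⊗ₜ a)

/-- An injective module over an `R`-algebra is right orthogonal to the flat `R`-modules. -/
theorem ExtVanishes.of_injective (B : Type u) [CommRing B] [Algebra R B] [Module B C]
    [IsScalarTower R B C] [Module.Injective B C] [Module.Flat R M] : ExtVanishes R M C := by
  obtain ⟨K, _, _, i, p, hi, hp, hex⟩ := exists_free_presentation R M
  refine .of_extend hi hp hex .of_projective fun f => ?_
  -- Flatness of `M` keeps `B ⊗ K → B ⊗ (M →₀ R)` injective, so the `B`-linear extension of `f`
  -- extends.
  obtain ⟨g, hg⟩ := Module.Injective.out (R := B) (i.baseChange B)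
    (LinearMap.lTensor_injective_of_exact_of_flat p hp i hi hex B)
    (f.liftBaseChange B)
  refine ⟨g.restrictScalars R ∘ₗ TensorProduct.mk R B _ 1, ?_⟩
  ext x
  simpa using hg (1 ⊗ₜ x)

/-- Given a morphism of short exact sequences whose right vertical map is injective with
cokernel `Q`, a map from `K` that extends to `P'` after the restriction to `K'` extends to `P`
if `Ext¹_R(Q, C) = 0`. -/
theorem ExtVanishes.exists_extend_of_ladder {M' P' K' Q : Type u} [AddCommGroup M'] [Module R M']
    [AddCommGroup P'] [Module R P'] [AddCommGroup K'] [Module R K'] [AddCommGroup Q] [Module R Q]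
    {i : K →ₗ[R] P} {p : P →ₗ[R] M} {i' : K' →ₗ[R] P'} {p' : P' →ₗ[R] M'}
    {k : K' →ₗ[R] K} {a : P' →ₗ[R] P} {m : M' →ₗ[R] M} {q : M →ₗ[R] Q}
    (hi : Function.Injective i) (hp : Function.Surjective p) (h : Function.Exact i p)
    (hp' : Function.Surjective p') (h' : Function.Exact i' p')
    (hik : i ∘ₗ k = a ∘ₗ i') (hpa : p ∘ₗ a = m ∘ₗ p')
    (hm : Function.Injective m) (hq : Function.Surjective q) (hmq : Function.Exact m q)
    (hQ : ExtVanishes R Q C) (f : K →ₗ[R] C) (g : P' →ₗ[R] C) (hfg : f ∘ₗ k = g ∘ₗ i') :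
    ∃ f' : P →ₗ[R] C, f' ∘ₗ i = f := by
  -- The range of `σ` is the kernel of `q ∘ₗ p`, so its cokernel is `Q`. Since `f.coprod g` kills
  -- the kernel of `σ`, it descends to this range and then extends to `P`.
  let σ : K × P' →ₗ[R] P := i.coprod a
  have hker : LinearMap.ker σ ≤ LinearMap.ker (f.coprod g) := by
    rintro ⟨x, y⟩ hxy
    have hxy : i x + a y = 0 := by simpa [σ] using hxy
    have h1 : p' y = 0 := hm (by
      rw [map_zero, ← LinearMap.comp_apply, ← hpa, LinearMap.comp_apply,
        eq_neg_of_add_eq_zero_right hxy, map_neg, h.apply_apply_eq_zero, neg_zero])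
    obtain ⟨z, rfl⟩ := (h' y).1 h1
    have h2 : x + k z = 0 := hi (by
      rw [map_zero, map_add, ← LinearMap.comp_apply i k, hik]; exact hxy)
    simp only [LinearMap.mem_ker, LinearMap.coprod_apply]
    rw [← LinearMap.comp_apply g, ← hfg, LinearMap.comp_apply, ← map_add, h2, map_zero]
  let e := σ.quotKerEquivRange
  let φ : LinearMap.range σ →ₗ[R] C := (LinearMap.ker σ).liftQ (f.coprod g) hker ∘ₗ e.symm
  have hφ : ∀ x, φ ⟨σ x, ⟨x, rfl⟩⟩ = f.coprod g x := by
    intro x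
    have : e.symm ⟨σ x, ⟨x, rfl⟩⟩ = Submodule.Quotient.mk x := by
      rw [LinearEquiv.symm_apply_eq]; rfl
    simp [φ, this]
  have hex : Function.Exact (LinearMap.range σ).subtype (q ∘ₗ p) := by
    intro y
    simp only [LinearMap.comp_apply, Submodule.subtype_apply, Set.mem_range, Subtype.exists,
      exists_prop, exists_eq_right]
    constructor
    · intro hy
      obtain ⟨z, hz⟩ := (hmq _).1 hy
      obtain ⟨w, rfl⟩ := hp' z
      obtain ⟨x, hx⟩ := (h (y - a w)).1 (by
        rw [map_sub, ← LinearMap.comp_apply p a, hpa, LinearMap.comp_apply, hz, sub_self])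
      exact ⟨(x, w), by simp [σ, hx]⟩
    · rintro ⟨⟨x, w⟩, rfl⟩
      simp only [σ, LinearMap.coprod_apply, map_add]
      rw [h.apply_apply_eq_zero, ← LinearMap.comp_apply p a, hpa, LinearMap.comp_apply,
        hmq.apply_apply_eq_zero]
      simp
  obtain ⟨f', hf'⟩ := hQ.exists_extend (i := (LinearMap.range σ).subtype) (p := q ∘ₗ p)
    Subtype.val_injective (hq.comp hp) hex φ
  refine ⟨f', LinearMap.ext fun x => ?_⟩
  have h1 := LinearMap.congr_fun hf' ⟨σ (x, 0), ⟨_, rfl⟩⟩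
  rw [hφ] at h1
  simpa [σ] using h1

end Vanishing

/-! ### Divisibility of `Ext¹` and descent from a localization. -/

section Divisibility

variable {R : Type u} [CommRing R] {M N P K C : Type u} [AddCommGroup M] [Module R M]
  [AddCommGroup N] [Module R N] [AddCommGroup P] [Module R P] [AddCommGroup K] [Module R K]
  [AddCommGroup C] [Module R C]

theorem flat_of_exact [Module.Flat R M] [Module.Flat R P] {i : K →ₗ[R] P} {p : P →ₗ[R] M}
    (hi : Function.Injective i) (hp : Function.Surjective p) (h : Function.Exact i p) :
    Module.Flat R K := by
  rw [Module.Flat.iff_lTensor_preserves_injective_linearMap]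
  intro A A' _ _ _ _ f hf
  have h1 : Function.Injective (i.rTensor A' ∘ₗ f.lTensor K) := by
    rw [LinearMap.rTensor_comp_lTensor, ← LinearMap.lTensor_comp_rTensor]
    have h2 : Function.Injective (i.rTensor A) := by
      rw [← LinearMap.comm_comp_lTensor_comp_comm_eq]
      simpa using LinearMap.lTensor_injective_of_exact_of_flat p hp i hi h A
    exact (Module.Flat.lTensor_preserves_injective_linearMap f hf).comp h2
  rw [LinearMap.coe_comp] at h1
  exact h1.of_comp

/-- Let `K` be a syzygy of `M`, and `0 → A → I → Q → 0` exact. If `Ext¹(K, I) = 0` and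
`Ext¹(M, Q) = 0`, then `Ext¹(K, A) = 0`, that is, `Ext²(M, A) = 0`. -/
theorem ExtVanishes.syzygy [Module.Projective R P] {i : K →ₗ[R] P} {p : P →ₗ[R] M}
    (hi : Function.Injective i) (hp : Function.Surjective p) (h : Function.Exact i p)
    {A I Q : Type u} [AddCommGroup A] [Module R A] [AddCommGroup I] [Module R I]
    [AddCommGroup Q] [Module R Q] {j : A →ₗ[R] I} {q : I →ₗ[R] Q} (hj : Function.Injective j)
    (hq : Function.Surjective q) (hjq : Function.Exact j q) (hI : ExtVanishes R K I)
    (hQ : ExtVanishes R M Q) : ExtVanishes R K A := by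
  refine .of_lift hj hq hjq hI fun f => ?_
  obtain ⟨g, rfl⟩ := hQ.exists_extend hi hp h f
  obtain ⟨g', rfl⟩ := Module.projective_lifting_property q g hq
  exact ⟨g' ∘ₗ i, rfl⟩

/-- If `Ext¹(M, C / t C) = 0` and `Ext²(M, C[t]) = 0`, then `Ext¹(M, C)` is `t`-divisible. -/
theorem exists_eq_smul_add [Module.Projective R P] {i : K →ₗ[R] P} {p : P →ₗ[R] M}
    (hi : Function.Injective i) (hp : Function.Surjective p) (h : Function.Exact i p) (t : R)
    {A Q : Type u} [AddCommGroup A] [Module R A] [AddCommGroup Q] [Module R Q]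
    {j : A →ₗ[R] C} {q : C →ₗ[R] Q} (hj : Function.Injective j)
    (hq : Function.Surjective q) (hjt : ∀ c, t • c = 0 ↔ c ∈ Set.range j)
    (hqt : ∀ c, q c = 0 ↔ ∃ c', t • c' = c) (hA : ExtVanishes R K A)
    (hQ : ExtVanishes R M Q) (f : K →ₗ[R] C) :
    ∃ (f' : K →ₗ[R] C) (g : P →ₗ[R] C), f = t • f' + g ∘ₗ i := by
  obtain ⟨g₀, hg₀⟩ := hQ.exists_extend hi hp h (q ∘ₗ f)
  obtain ⟨g, rfl⟩ := Module.projective_lifting_property q g₀ hq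
  let m : C →ₗ[R] C := LinearMap.lsmul R C t
  have hf : ∀ x, (f - g ∘ₗ i) x ∈ LinearMap.range m := by
    intro x
    have : q ((f - g ∘ₗ i) x) = 0 := by
      have := LinearMap.congr_fun hg₀ x
      simp only [LinearMap.comp_apply] at this
      simp [this]
    obtain ⟨c, hc⟩ := (hqt _).1 this
    exact ⟨c, hc⟩
  obtain ⟨f', hf'⟩ := hA.exists_lift (p := m.rangeRestrict) hj m.surjective_rangeRestrict
    (fun c => by
      rw [← hjt, ← Subtype.val_inj]; rfl) ((f - g ∘ₗ i).codRestrict _ hf)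
  refine ⟨f', g, LinearMap.ext fun x => ?_⟩
  have h1 : t • f' x = f x - g (i x) := congrArg Subtype.val (LinearMap.congr_fun hf' x)
  simp [h1]

/-- If `S` is countable, `Ext¹(M, C)` is divisible by the elements of `S`, and
`Ext¹(S⁻¹M, C) = 0`, then `Ext¹(M, C) = 0`. -/
theorem ExtVanishes.of_localizedModule [Module.Projective R P] {i : K →ₗ[R] P} {p : P →ₗ[R] M}
    (hi : Function.Injective i) (hp : Function.Surjective p) (h : Function.Exact i p)
    {S : Submonoid R} (hS : (S : Set R).Countable) (l : M →ₗ[R] N) [IsLocalizedModule S l]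
    (hN : ExtVanishes R N C)
    (hdiv : ∀ t ∈ S, ∀ f : K →ₗ[R] C, ∃ (f' : K →ₗ[R] C) (g : P →ₗ[R] C), f = t • f' + g ∘ₗ i) :
    ExtVanishes R M C := by
  obtain ⟨s, hs⟩ := exists_seq_frequently_eq hS
  refine .of_extend hi hp h .of_projective fun f => ?_
  choose φ γ hφ using fun (n : ℕ) (f : K →ₗ[R] C) => hdiv (s n) (s n).2 f
  -- Successive division: modulo maps extending to `P`, `F 0 = f` and `F n = s n • F (n + 1)`. The
  -- family of classes is thus killed by the telescope, which acts injectively on `Ext¹` because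
  -- `Ext¹(N, C) = 0`; hence the class of `F 0` is zero.
  let F : ℕ → (K →ₗ[R] C) := fun n => Nat.rec f φ n
  obtain ⟨g, hg⟩ := ExtVanishes.exists_extend_of_ladder
    (i := Finsupp.mapRange.linearMap (α := ℕ) i) (p := Finsupp.mapRange.linearMap p)
    (i' := Finsupp.mapRange.linearMap (α := ℕ) i) (p' := Finsupp.mapRange.linearMap p)
    (Finsupp.mapRange_injective i (map_zero i) hi)
    (Finsupp.mapRange_surjective _ (map_zero p) hp) (mapRange_exact (ι := ℕ) h)
    (Finsupp.mapRange_surjective _ (map_zero p) hp) (mapRange_exact (ι := ℕ) h)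
    (telescope_comp_mapRange (fun n => (s n : R)) i).symm
    (telescope_comp_mapRange (fun n => (s n : R)) p).symm
    (telescope_injective _) (telescopeTo_surjective hs l) (telescope_exact hs l) hN
    (Finsupp.lsum R F) (Finsupp.lsum R fun n => γ n (F n)) (by
      ext n x
      have h1 : F n x = (s n : R) • F (n + 1) x + γ n (F n) (i x) :=
        LinearMap.congr_fun (hφ n (F n)) x
      simp [Finsupp.sum_sub_index, h1])
  refine ⟨g ∘ₗ Finsupp.lsingle 0, LinearMap.ext fun x => ?_⟩
  simpa [F] using LinearMap.congr_fun hg (Finsupp.single 0 x)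

end Divisibility

/-! ### Cotorsion modules over semiprimary algebras. -/

section Cotorsion

variable {R : Type u} [CommRing R]

/-- The cotorsion modules: those right `Ext¹`-orthogonal to all flat modules. -/
def IsCotorsion (R : Type u) [CommRing R] (C : Type u) [AddCommGroup C] [Module R C] : Prop :=
  ∀ (F : Type u) [AddCommGroup F] [Module R F], Module.Flat R F → ExtVanishes R F C

theorem IsCotorsion.of_injective (B C : Type u) [CommRing B] [Algebra R B] [AddCommGroup C]
    [Module R C] [Module B C] [IsScalarTower R B C] [Module.Injective B C] : IsCotorsion R C :=
  fun _ _ _ _ => ExtVanishes.of_injective B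

theorem isScalarTower_of_tower {B B' D : Type*} [CommRing B] [Algebra R B] [CommRing B']
    [Algebra B B'] [Algebra R B'] [IsScalarTower R B B'] [AddCommGroup D] [Module R D]
    [Module B D] [Module B' D] [IsScalarTower R B D] [IsScalarTower B B' D] :
    IsScalarTower R B' D :=
  .of_algebraMap_smul fun r x => by
    rw [IsScalarTower.algebraMap_apply R B B', algebraMap_smul, algebraMap_smul]

/-- With `J` the nilpotent Jacobson radical, `C/JC` is a module over the semisimple ring `B/J`,
hence injective there and cotorsion over `R`. Induction on the power of `J` killing `C` handles
`JC`, and cotorsion modules are closed under extensions. -/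
theorem IsCotorsion.of_isArtinianRing (B : Type u) [CommRing B] [Algebra R B]
    [IsSemiprimaryRing B] (C : Type u) [AddCommGroup C] [Module R C] [Module B C]
    [IsScalarTower R B C] : IsCotorsion R C := by
  obtain ⟨n, hn⟩ := IsSemiprimaryRing.isNilpotent (R := B)
  have hC : (Ring.jacobson B ^ n • ⊤ : Submodule B C) = ⊥ := by
    rw [hn]; exact Submodule.bot_smul _
  clear hn
  induction n generalizing C with
  | zero =>
    intro F _ _ _
    have hsub : Subsingleton C := by
      rw [pow_zero, Ideal.one_eq_top, Submodule.top_smul] at hC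
      exact (Submodule.subsingleton_iff B).1 (subsingleton_of_bot_eq_top hC.symm)
    obtain ⟨K, _, _, i, p, hi, hp, hex⟩ := exists_free_presentation R F
    exact .of_extend hi hp hex .of_projective fun f => ⟨0, LinearMap.ext fun x =>
      Subsingleton.elim _ _⟩
  | succ n ih =>
    let N : Submodule B C := Ring.jacobson B • ⊤
    have hN : IsCotorsion R N := by
      refine ih N ?_
      apply Submodule.map_injective_of_injective N.subtype_injective
      rw [Submodule.map_smul'', Submodule.map_subtype_top, Submodule.map_bot, ← hC,
        ← Submodule.mul_smul, pow_succ]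
    have hss : IsSemisimpleRing (B ⧸ Ring.jacobson B) := IsSemiprimaryRing.isSemisimpleRing
    have hQ : IsCotorsion R (C ⧸ N) := by
      have : Module.Injective (B ⧸ Ring.jacobson B) (C ⧸ N) :=
        Module.injective_of_isSemisimpleRing _ _
      have : IsScalarTower B (B ⧸ Ring.jacobson B) (C ⧸ N) := inferInstance
      have : IsScalarTower R (B ⧸ Ring.jacobson B) (C ⧸ N) := isScalarTower_of_tower (B := B)
      exact .of_injective (B ⧸ Ring.jacobson B) _
    intro F _ _ hF
    exact .of_exact (i := N.subtype.restrictScalars R) (p := N.mkQ.restrictScalars R)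
      N.subtype_injective N.mkQ_surjective (LinearMap.exact_subtype_mkQ N) (hN F hF) (hQ F hF)

theorem exists_injective_module (B A : Type u) [CommRing B] [Algebra R B] [AddCommGroup A]
    [Module R A] [Module B A] [IsScalarTower R B A] :
    ∃ (I : Type u) (_ : AddCommGroup I) (_ : Module R I) (_ : Module B I)
      (_ : IsScalarTower R B I) (j : A →ₗ[B] I), Module.Injective B I ∧ Function.Injective j := by
  let J := Injective.under (ModuleCat.of B A)
  let _ : Module R J := Module.compHom J (algebraMap R B)
  refine ⟨J, inferInstance, inferInstance, inferInstance, .of_algebraMap_smul fun r x => rfl,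
    (Injective.ι (ModuleCat.of B A)).hom, ?_, ?_⟩
  · have : Injective (ModuleCat.of B J) := inferInstanceAs (Injective (Injective.under _))
    exact Module.injective_module_of_injective_object B J
  · exact (ModuleCat.mono_iff_injective _).1 inferInstance

end Cotorsion

/-! ### Iterated localization and `Hom` from a localization. -/

section Localization

variable {R : Type u} [CommRing R]

instance isLocalizedModule_localization_sup (S T : Submonoid R) :
    IsLocalizedModule S (IsLocalizedModule.liftOfLE T (S ⊔ T) le_sup_right
      (Algebra.linearMap R (Localization T)) (Algebra.linearMap R (Localization (S ⊔ T)))) where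
  map_units s := IsLocalizedModule.map_units (Algebra.linearMap R (Localization (S ⊔ T)))
    ⟨s, (le_sup_left : S ≤ S ⊔ T) s.2⟩
  surj y := by
    obtain ⟨⟨r, u⟩, rfl⟩ := IsLocalizedModule.mk'_surjective (S ⊔ T)
      (Algebra.linearMap R (Localization (S ⊔ T))) y
    obtain ⟨u, hu⟩ := u
    obtain ⟨s, hs, t, ht, rfl⟩ := Submonoid.mem_sup.1 hu
    refine ⟨⟨IsLocalizedModule.mk' (Algebra.linearMap R (Localization T)) r ⟨t, ht⟩, ⟨s, hs⟩⟩, ?_⟩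
    rw [IsLocalizedModule.liftOfLE_mk']
    have := IsLocalizedModule.mk'_cancel_left (Algebra.linearMap R (Localization (S ⊔ T))) r
      ⟨s, (le_sup_left : S ≤ S ⊔ T) hs⟩ ⟨t, (le_sup_right : T ≤ S ⊔ T) ht⟩
    rw [Submonoid.smul_def, IsLocalizedModule.mk'_smul] at this
    exact this
  exists_of_eq {x y} hxy := by
    rw [← sub_eq_zero, ← map_sub] at hxy
    obtain ⟨⟨r, t⟩, hr⟩ := IsLocalizedModule.mk'_surjective T
      (Algebra.linearMap R (Localization T)) (x - y)
    simp only [Function.uncurry_apply_pair] at hr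
    rw [← hr, IsLocalizedModule.liftOfLE_mk', IsLocalizedModule.mk'_eq_zero'] at hxy
    obtain ⟨⟨u, hu⟩, hur⟩ := hxy
    obtain ⟨s, hs, t', ht', rfl⟩ := Submonoid.mem_sup.1 hu
    refine ⟨⟨s, hs⟩, ?_⟩
    rw [← sub_eq_zero, ← smul_sub, ← hr, Submonoid.smul_def, ← IsLocalizedModule.mk'_smul,
      IsLocalizedModule.mk'_eq_zero']
    refine ⟨⟨t', ht'⟩, ?_⟩
    rw [← hur]
    simp only [Submonoid.smul_def, smul_eq_mul]
    ring

/-- `T⁻¹R ⊗ S⁻¹R` is the localization of `R` at the submonoid generated by `S` and `T`. -/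
noncomputable def localizationSupEquiv (S T : Submonoid R) :
    Localization (S ⊔ T) ≃ₗ[R] TensorProduct R (Localization T) (Localization S) :=
  (IsLocalizedModule.linearEquiv S (IsLocalizedModule.liftOfLE T (S ⊔ T) le_sup_right
      (Algebra.linearMap R (Localization T)) (Algebra.linearMap R (Localization (S ⊔ T))))
    (TensorProduct.mk R (Localization S) (Localization T) 1)).trans
    (TensorProduct.comm R _ _)

/-- The elements of `S` act by automorphisms on `Hom_R(S⁻¹R, C)`. -/
theorem isLocalizedModule_id_hom (S : Submonoid R) (B C : Type u) [CommRing B] [Algebra R B]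
    [AddCommGroup C] [Module R C] [Module B C] [IsScalarTower R B C] :
    IsLocalizedModule (Algebra.algebraMapSubmonoid B S)
      (LinearMap.id : (Localization S →ₗ[R] C) →ₗ[B] (Localization S →ₗ[R] C)) where
  map_units := by
    rintro ⟨_, s, hs, rfl⟩
    have hu : ∀ a : Localization S,
        s • IsLocalization.mk' (Localization S) 1 (⟨s, hs⟩ : S) * a = a := by
      intro a
      have := IsLocalization.mk'_spec' (Localization S) 1 (⟨s, hs⟩ : S)
      rw [map_one] at this
      rw [Algebra.smul_def, this, one_mul]
    rw [Module.End.isUnit_iff]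
    constructor
    · intro f g hfg
      ext a
      have h1 := LinearMap.congr_fun hfg (IsLocalization.mk' (Localization S) 1 (⟨s, hs⟩ : S) * a)
      simp only [Module.algebraMap_end_apply, algebraMap_smul, LinearMap.smul_apply, ← map_smul]
        at h1
      rwa [← smul_mul_assoc, hu] at h1
    · intro f
      refine ⟨f ∘ₗ LinearMap.mulLeft R (IsLocalization.mk' (Localization S) 1 (⟨s, hs⟩ : S)), ?_⟩
      ext a
      simp only [Module.algebraMap_end_apply, algebraMap_smul, LinearMap.smul_apply,
        LinearMap.comp_apply, LinearMap.mulLeft_apply, ← map_smul]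
      rw [← smul_mul_assoc, hu]
  surj y := ⟨(y, 1), by simp⟩
  exists_of_eq h := ⟨1, by simpa using h⟩

end Localization

/-! ### Induction on the list of separating submonoids. -/

section Induction

variable {R : Type u} [CommRing R]

/-- Any two primes `p < q` of the `R`-algebra `B` are separated by one of the submonoids in `l`:
it meets `q`, but not `p`. -/
def SeparatedBy (l : List (Submonoid R)) (B : Type u) [CommRing B] [Algebra R B] : Prop :=
  ∀ p q : PrimeSpectrum B, p < q →
    ∃ S ∈ l, (∃ s ∈ S, algebraMap R B s ∈ q.asIdeal) ∧ ∀ s ∈ S, algebraMap R B s ∉ p.asIdeal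

/-- In `B'` the set `S` separates nothing: if it contains an element that becomes zero it meets
every prime, and if its elements become units it meets none. Injectivity on spectra keeps inclusions
strict. -/
theorem SeparatedBy.of_cons {l : List (Submonoid R)} {S : Submonoid R} {B B' : Type u} [CommRing B]
    [Algebra R B] [CommRing B'] [Algebra R B'] [Algebra B B'] [IsScalarTower R B B']
    (h : SeparatedBy (S :: l) B) (hinj : Function.Injective (PrimeSpectrum.comap (algebraMap B B')))
    (hS : (∃ s ∈ S, algebraMap R B' s = 0) ∨ ∀ s ∈ S, IsUnit (algebraMap R B' s)) :
    SeparatedBy l B' := by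
  intro p q hpq
  obtain ⟨T, hT, ⟨t, ht, htq⟩, hp⟩ := h (PrimeSpectrum.comap (algebraMap B B') p)
    (PrimeSpectrum.comap (algebraMap B B') q)
    (lt_of_le_of_ne (Ideal.comap_mono hpq.le) fun h => hpq.ne (hinj h))
  simp only [PrimeSpectrum.comap_asIdeal, Ideal.mem_comap,
    ← IsScalarTower.algebraMap_apply R B B'] at htq hp
  rcases List.mem_cons.1 hT with rfl | hT
  · rcases hS with ⟨s, hs, hs0⟩ | hS
    · exact absurd (hs0 ▸ zero_mem _) (hp s hs)
    · exact absurd (Ideal.eq_top_of_isUnit_mem _ htq (hS t ht)) q.2.ne_top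
  · exact ⟨T, hT, ⟨t, ht, htq⟩, hp⟩

theorem SeparatedBy.isArtinianRing {B : Type u} [CommRing B] [Algebra R B] [IsNoetherianRing B]
    (h : SeparatedBy ([] : List (Submonoid R)) B) : IsArtinianRing B := by
  rw [isArtinianRing_iff_krullDimLE_zero, Ring.krullDimLE_zero_iff]
  intro I hI
  obtain ⟨m, hm, hIm⟩ := I.exists_le_maximal hI.ne_top
  rcases eq_or_lt_of_le hIm with rfl | hlt
  · exact hm
  · obtain ⟨S, hS, -⟩ := h ⟨I, hI⟩ ⟨m, hm.isPrime⟩ hlt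
    simp at hS

/-- `Ext¹(S⁻¹R, C) = 0` for all `S` in `𝒮`. -/
def IsOrthogonal (𝒮 : Set (Submonoid R)) (C : Type u) [AddCommGroup C] [Module R C] : Prop :=
  ∀ S ∈ 𝒮, ExtVanishes R (Localization S) C

theorem IsCotorsion.isOrthogonal {C : Type u} [AddCommGroup C] [Module R C]
    (h : IsCotorsion R C) (𝒮 : Set (Submonoid R)) : IsOrthogonal 𝒮 C :=
  fun S _ => h _ (IsLocalization.flat _ S)

theorem IsOrthogonal.of_surjective {𝒮 : Set (Submonoid R)}
    (h𝒮 : ∀ S ∈ 𝒮, (S : Set R).Countable) {C D : Type u} [AddCommGroup C] [Module R C]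
    [AddCommGroup D] [Module R D] (h : IsOrthogonal 𝒮 C) {p : C →ₗ[R] D}
    (hp : Function.Surjective p) : IsOrthogonal 𝒮 D :=
  fun S hS => (h S hS).localization_of_surjective (h𝒮 S hS) hp

/-- Hom-tensor adjunction reduces to `T⁻¹R ⊗ S⁻¹R`, the localization at `S ⊔ T`. This is why joins
of the `S j` must belong to the family. -/
theorem IsOrthogonal.hom {𝒮 : Set (Submonoid R)} (hsup : ∀ S ∈ 𝒮, ∀ T ∈ 𝒮, S ⊔ T ∈ 𝒮)
    {S : Submonoid R} (hS : S ∈ 𝒮) {C : Type u} [AddCommGroup C] [Module R C]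
    (h : IsOrthogonal 𝒮 C) : IsOrthogonal 𝒮 (Localization S →ₗ[R] C) := by
  intro T hT
  have : Module.Flat R (Localization S) := IsLocalization.flat _ S
  exact ((h _ (hsup S hS T hT)).congr_left (localizationSupEquiv S T)).of_tensor

theorem exists_module_quotient_span (B A : Type u) [CommRing B] [Algebra R B] [AddCommGroup A]
    [Module R A] [Module B A] [IsScalarTower R B A] (b : B) (h : ∀ a : A, b • a = 0) :
    ∃ _ : Module (B ⧸ Ideal.span {b}) A, IsScalarTower R (B ⧸ Ideal.span {b}) A := by
  have hb : Module.IsTorsionBySet B A (Ideal.span {b} : Set B) :=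
    (Module.isTorsionBySet_span_singleton_iff b).2 fun a => h a
  let _ : Module (B ⧸ Ideal.span {b}) A := hb.module
  have : IsScalarTower B (B ⧸ Ideal.span {b}) A := .of_algebraMap_smul fun _ _ => rfl
  exact ⟨inferInstance, isScalarTower_of_tower (B := B)⟩

theorem exists_torsion_module (B C : Type u) [CommRing B] [Algebra R B] [AddCommGroup C]
    [Module R C] [Module B C] [IsScalarTower R B C] (b : B) :
    ∃ (A : Type u) (_ : AddCommGroup A) (_ : Module R A) (_ : Module (B ⧸ Ideal.span {b}) A)
      (_ : IsScalarTower R (B ⧸ Ideal.span {b}) A) (j : A →ₗ[R] C),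
      Function.Injective j ∧ ∀ c, b • c = 0 ↔ c ∈ Set.range j := by
  let m := LinearMap.ker (LinearMap.lsmul B C b)
  obtain ⟨h1, h2⟩ := exists_module_quotient_span (R := R) B m b fun a => Subtype.ext a.2
  exact ⟨m, inferInstance, inferInstance, h1, h2, m.subtype.restrictScalars R,
    Subtype.val_injective, fun c => ⟨fun h => ⟨⟨c, h⟩, rfl⟩, by rintro ⟨a, rfl⟩; exact a.2⟩⟩

theorem exists_quotient_module (B C : Type u) [CommRing B] [Algebra R B] [AddCommGroup C]
    [Module R C] [Module B C] [IsScalarTower R B C] (b : B) :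
    ∃ (Q : Type u) (_ : AddCommGroup Q) (_ : Module R Q) (_ : Module (B ⧸ Ideal.span {b}) Q)
      (_ : IsScalarTower R (B ⧸ Ideal.span {b}) Q) (q : C →ₗ[R] Q),
      Function.Surjective q ∧ ∀ c, q c = 0 ↔ ∃ c', b • c' = c := by
  let m := LinearMap.range (LinearMap.lsmul B C b)
  obtain ⟨h1, h2⟩ := exists_module_quotient_span (R := R) B (C ⧸ m) b fun a => by
    obtain ⟨c, rfl⟩ := m.mkQ_surjective a
    exact (Submodule.Quotient.mk_eq_zero m).2 ⟨c, rfl⟩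
  exact ⟨C ⧸ m, inferInstance, inferInstance, h1, h2, m.mkQ.restrictScalars R,
    m.mkQ_surjective, fun c => Submodule.Quotient.mk_eq_zero m⟩

/-- Embedding of a module over an `R`-algebra into an injective one, with its cokernel. -/
theorem exists_injective_coresolution (B A : Type u) [CommRing B] [Algebra R B] [AddCommGroup A]
    [Module R A] [Module B A] [IsScalarTower R B A] :
    ∃ (I Q : Type u) (_ : AddCommGroup I) (_ : Module R I) (_ : AddCommGroup Q) (_ : Module R Q)
      (_ : Module B Q) (_ : IsScalarTower R B Q) (j : A →ₗ[R] I) (q : I →ₗ[R] Q),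
      IsCotorsion R I ∧ Function.Injective j ∧ Function.Surjective q ∧ Function.Exact j q := by
  obtain ⟨I, _, _, _, _, j, hI, hj⟩ := exists_injective_module (R := R) B A
  let m := LinearMap.range j
  have hex : ∀ x, m.mkQ x = 0 ↔ x ∈ Set.range j := fun x => Submodule.Quotient.mk_eq_zero m
  exact ⟨I, I ⧸ m, _, _, inferInstance, inferInstance, inferInstance, inferInstance,
    j.restrictScalars R, m.mkQ.restrictScalars R, .of_injective B I, hj, m.mkQ_surjective, hex⟩

/-- Suppose that, for every algebra whose spectrum is separated by `l`, the modules orthogonal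
to the localizations are cotorsion. If the spectrum of `B` is separated by `S :: l`, then
`Ext¹(F, C) = 0` as soon as `Ext¹(S⁻¹F, C) = 0`, for any flat `F`. -/
theorem ExtVanishes.of_tensor_localization {𝒮 : Set (Submonoid R)}
    (h𝒮 : ∀ S ∈ 𝒮, (S : Set R).Countable) {l : List (Submonoid R)} {S : Submonoid R} (hS : S ∈ 𝒮)
    (ih : ∀ (B : Type u) [CommRing B] [Algebra R B] [IsNoetherianRing B], SeparatedBy l B →
      ∀ (C : Type u) [AddCommGroup C] [Module R C] [Module B C] [IsScalarTower R B C],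
        IsOrthogonal 𝒮 C → IsCotorsion R C)
    (B : Type u) [CommRing B] [Algebra R B] [IsNoetherianRing B] (hB : SeparatedBy (S :: l) B)
    (C : Type u) [AddCommGroup C] [Module R C] [Module B C] [IsScalarTower R B C]
    (hC : IsOrthogonal 𝒮 C) (F : Type u) [AddCommGroup F] [Module R F] [Module.Flat R F]
    (h : ExtVanishes R (TensorProduct R (Localization S) F) C) : ExtVanishes R F C := by
  obtain ⟨K, _, _, i, p, hi, hp, hex⟩ := exists_free_presentation R F
  have hK : Module.Flat R K := flat_of_exact hi hp hex
  refine .of_localizedModule hi hp hex (h𝒮 S hS) (TensorProduct.mk R (Localization S) F 1) h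
    fun t ht => ?_
  let b : B := algebraMap R B t
  let B' := B ⧸ Ideal.span {b}
  have hB' : SeparatedBy l B' := hB.of_cons
    (PrimeSpectrum.comap_injective_of_surjective _ Ideal.Quotient.mk_surjective)
    (.inl ⟨t, ht, by
      rw [IsScalarTower.algebraMap_apply R B B']
      exact Ideal.Quotient.eq_zero_iff_mem.2 (Ideal.mem_span_singleton_self b)⟩)
  obtain ⟨A, _, _, _, _, j, hj, hjb⟩ := exists_torsion_module (R := R) B C b
  obtain ⟨Q, _, _, _, _, q, hq, hqb⟩ := exists_quotient_module (R := R) B C b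
  have hQ : IsCotorsion R Q := ih B' hB' Q (hC.of_surjective h𝒮 hq)
  -- This is `Ext²(F, A) = 0`. The submodule `A` of `C` need not inherit orthogonality, but the
  -- cokernel of `A` in an injective `B'`-module does, as a quotient of a cotorsion module.
  have hA : ExtVanishes R K A := by
    obtain ⟨I, Q', _, _, _, _, _, _, j, q, hI, hj, hq, hjq⟩ :=
      exists_injective_coresolution (R := R) B' A
    exact .syzygy hi hp hex hj hq hjq (hI K hK)
      (ih B' hB' Q' ((hI.isOrthogonal 𝒮).of_surjective h𝒮 hq) F inferInstance)
  exact exists_eq_smul_add hi hp hex t hj hq (fun c => by rw [← hjb, algebraMap_smul])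
    (fun c => by simp only [hqb, b, algebraMap_smul]) hA (hQ F inferInstance)

theorem isCotorsion_of_separatedBy {𝒮 : Set (Submonoid R)}
    (h𝒮 : ∀ S ∈ 𝒮, (S : Set R).Countable) (hsup : ∀ S ∈ 𝒮, ∀ T ∈ 𝒮, S ⊔ T ∈ 𝒮)
    (l : List (Submonoid R)) (hl : ∀ S ∈ l, S ∈ 𝒮) :
    ∀ (B : Type u) [CommRing B] [Algebra R B] [IsNoetherianRing B], SeparatedBy l B →
      ∀ (C : Type u) [AddCommGroup C] [Module R C] [Module B C] [IsScalarTower R B C],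
        IsOrthogonal 𝒮 C → IsCotorsion R C := by
  induction l with
  | nil =>
    intro B _ _ _ hB C _ _ _ _ _
    have := hB.isArtinianRing
    exact .of_isArtinianRing B C
  | cons S l ih =>
    have hS : S ∈ 𝒮 := hl S List.mem_cons_self
    replace ih := ih fun T hT => hl T (List.mem_cons_of_mem S hT)
    intro B _ _ _ hB C _ _ _ _ hC F _ _ _
    refine .of_tensor_localization h𝒮 hS ih B hB C hC F ?_
    have : Module.Flat R (Localization S) := IsLocalization.flat _ S
    refine ExtVanishes.congr_left (TensorProduct.comm R F (Localization S)) ((hC S hS).tensor ?_)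
    let m := Algebra.algebraMapSubmonoid B S
    let B' := Localization m
    -- Since `Ext¹(S⁻¹R, C) = 0`, the vanishing for `F ⊗ S⁻¹R` follows from that of `Ext¹(F, D)`. As
    -- `S` acts invertibly on `D`, it is an `S⁻¹B`-module, to which the induction hypothesis
    -- applies.
    let D := Localization S →ₗ[R] C
    have := isLocalizedModule_id_hom S B C
    let _ : Module B' D := IsLocalizedModule.module m (LinearMap.id : D →ₗ[B] D)
    have : IsScalarTower B B' D := IsLocalizedModule.isScalarTower_module m _
    have : IsScalarTower R B' D := isScalarTower_of_tower (B := B)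
    have : IsNoetherianRing B' := IsLocalization.isNoetherianRing m _ inferInstance
    have hB' : SeparatedBy l B' := hB.of_cons (PrimeSpectrum.localization_comap_injective B' m)
      (.inr fun s hs => by
        rw [IsScalarTower.algebraMap_apply R B B']
        exact IsLocalization.map_units B' (⟨_, s, hs, rfl⟩ : m))
    exact ih B' hB' D (hC.hom hsup hS) F inferInstance

end Induction

/-! ### Separating primes by prime avoidance. -/

section Separation

variable {R : Type u} [CommRing R] {ι : Type*} [Fintype ι]

theorem countable_closure {X : Set R} (hX : X.Countable) :
    (Submonoid.closure X : Set R).Countable := by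
  have := hX.to_subtype
  have : Countable (FreeMonoid X) := inferInstanceAs (Countable (List X))
  rw [Submonoid.closure_eq_mrange, MonoidHom.coe_mrange]
  exact Set.countable_range _

open Classical in
/-- The indices `j` such that the prime `p` meets `A j`. -/
noncomputable def touched (A : ι → Set R) (p : PrimeSpectrum R) : Finset ι :=
  {j | ∃ a ∈ A j, a ∈ p.asIdeal}

theorem mem_touched {A : ι → Set R} {p : PrimeSpectrum R} {j : ι} :
    j ∈ touched A p ↔ ∃ a ∈ A j, a ∈ p.asIdeal := by
  simp [touched]

theorem touched_mono {A A' : ι → Set R} (h : A ≤ A') {p q : PrimeSpectrum R} (hpq : p ≤ q) :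
    touched A p ⊆ touched A' q := fun j hj => by
  obtain ⟨a, ha, hap⟩ := mem_touched.1 hj
  exact mem_touched.2 ⟨a, h j ha, hpq hap⟩

/-- Every prime meets at most as many of the sets as its height. -/
def HeightBounded (A : ι → Set R) : Prop :=
  ∀ p : PrimeSpectrum R, ((touched A p).card : ℕ∞) ≤ p.asIdeal.height

variable [IsNoetherianRing R]

/-- Only finitely many primes meet exactly as many of the sets as their height. -/
theorem HeightBounded.finite_saturated {A : ι → Set R} (hA : HeightBounded A)
    (hfin : ∀ j, (A j).Finite) :
    {p : PrimeSpectrum R | ((touched A p).card : ℕ∞) = p.asIdeal.height}.Finite := by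
  have hU : (⋃ j, A j).Finite := Set.finite_iUnion hfin
  have hfin2 : (⋃ X ∈ (⋃ j, A j).powerset, (Ideal.span X).minimalPrimes).Finite :=
    hU.finite_subsets.biUnion fun X _ => Ideal.finite_minimalPrimes_of_isNoetherianRing R _
  refine Set.Finite.of_finite_image (f := PrimeSpectrum.asIdeal) (hfin2.subset ?_)
    (fun p _ q _ h => PrimeSpectrum.ext h)
  rintro _ ⟨p, hp, rfl⟩
  -- The prime `p` is minimal over the ideal generated by its elements in the `A j`: a smaller prime
  -- containing them meets the same sets, so the height bound gives it height at least that of `p`.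
  have hle : Ideal.span ((⋃ j, A j) ∩ p.asIdeal) ≤ p.asIdeal :=
    Ideal.span_le.2 Set.inter_subset_right
  obtain ⟨q, hq, hqp⟩ := Ideal.exists_minimalPrimes_le hle
  have hqprime : q.IsPrime := hq.1.1
  suffices q = p.asIdeal by
    subst this
    exact Set.mem_biUnion (x := (⋃ j, A j) ∩ p.asIdeal) Set.inter_subset_left hq
  have h1 : touched A p ⊆ touched A ⟨q, hqprime⟩ := fun j hj => by
    obtain ⟨a, ha, hap⟩ := mem_touched.1 hj
    exact mem_touched.2 ⟨a, ha, hq.1.2 (Ideal.subset_span ⟨Set.mem_iUnion_of_mem j ha, hap⟩)⟩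
  have h2 : p.asIdeal.height ≤ q.height := by
    rw [← (show _ = _ from hp)]
    exact le_trans (by exact_mod_cast Finset.card_le_card h1) (hA ⟨q, hqprime⟩)
  by_contra hne
  exact absurd (Ideal.height_strict_mono_of_isPrime_of_isPrime (lt_of_le_of_ne hqp hne))
    (not_lt.2 h2)

/-- If a prime of height at least `card ι - 1` meets fewer sets than its height, then one can add
an element of this prime to any of the sets not met. -/
theorem HeightBounded.exists_insert {A : ι → Set R} (hA : HeightBounded A)
    (hfin : ∀ j, (A j).Finite) {p : PrimeSpectrum R}
    (hp : (Fintype.card ι : ℕ∞) ≤ p.asIdeal.height + 1)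
    (hlt : ((touched A p).card : ℕ∞) < p.asIdeal.height) {j : ι} (hj : j ∉ touched A p) :
    ∃ A' : ι → Set R, A ≤ A' ∧ HeightBounded A' ∧ (∀ j, (A' j).Finite) ∧
      touched A p ⊆ touched A' p ∧ j ∈ touched A' p := by
  classical
  -- Adding `t` to `A j` breaks the bound only at saturated primes that contain `t` and miss `A j`.
  -- Those missing `A j` are finite in number, so prime avoidance applies unless one of them
  -- contains `p`.
  obtain ⟨t, htp, ht⟩ : ∃ t ∈ p.asIdeal, ∀ q : PrimeSpectrum R,
      ((touched A q).card : ℕ∞) = q.asIdeal.height → j ∉ touched A q → t ∉ q.asIdeal := by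
    by_contra! hcon
    have hsf : {q : PrimeSpectrum R | ((touched A q).card : ℕ∞) = q.asIdeal.height ∧
        j ∉ touched A q}.Finite := (hA.finite_saturated hfin).subset fun q hq => hq.1
    have hsub : (p.asIdeal : Set R) ⊆ ⋃ q ∈ {q : PrimeSpectrum R |
        ((touched A q).card : ℕ∞) = q.asIdeal.height ∧ j ∉ touched A q}, (q.asIdeal : Set R) := by
      intro t ht
      obtain ⟨q, h1, h2, h3⟩ := hcon t ht
      exact Set.mem_biUnion (x := q) ⟨h1, h2⟩ h3
    obtain ⟨q, ⟨hq, hjq⟩, hpq⟩ := (Ideal.subset_union_prime_finite hsf (f := PrimeSpectrum.asIdeal)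
      p p fun q _ _ _ => q.2).1 hsub
    have hne : p ≠ q := by rintro rfl; exact hlt.ne hq
    have hlt' : p.asIdeal < q.asIdeal := lt_of_le_of_ne hpq fun h => hne (PrimeSpectrum.ext h)
    -- A saturated `q` strictly above `p` has height at least `card ι`, so it meets all the sets,
    -- including `A j`. This is where the lower bound on the height of `p` enters.
    have h1 := Ideal.height_strict_mono_of_isPrime_of_isPrime hlt'
    have h2 : (Fintype.card ι : ℕ∞) ≤ (touched A q).card := by
      rw [hq]; exact hp.trans (Order.add_one_le_of_lt h1)
    have h3 : touched A q = Finset.univ :=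
      Finset.eq_univ_of_card _ (le_antisymm (Finset.card_le_univ _) (by exact_mod_cast h2))
    exact hjq (h3 ▸ Finset.mem_univ j)
  have hle : A ≤ Function.update A j (insert t (A j)) := by
    intro k
    by_cases hk : k = j
    · subst hk; simp
    · simp [hk]
  refine ⟨Function.update A j (insert t (A j)), hle, fun q => ?_, fun k => ?_, ?_⟩
  · have hsub : touched (Function.update A j (insert t (A j))) q ⊆ insert j (touched A q) := by
      intro k hk
      by_cases hkj : k = j
      · simp [hkj]
      · rw [mem_touched, Function.update_of_ne hkj, ← mem_touched] at hk
        exact Finset.mem_insert_of_mem hk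
    by_cases hjq : j ∈ touched A q
    · rw [Finset.insert_eq_of_mem hjq] at hsub
      exact le_trans (by exact_mod_cast Finset.card_le_card hsub) (hA q)
    · by_cases hq : ((touched A q).card : ℕ∞) = q.asIdeal.height
      · have hsub' : touched (Function.update A j (insert t (A j))) q ⊆ touched A q := by
          intro k hk
          rcases Finset.mem_insert.1 (hsub hk) with rfl | h
          · obtain ⟨a, ha, haq⟩ := mem_touched.1 hk
            rw [Function.update_self] at ha
            rcases ha with rfl | ha
            · exact absurd haq (ht q hq hjq)
            · exact mem_touched.2 ⟨a, ha, haq⟩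
          · exact h
        exact le_trans (by exact_mod_cast Finset.card_le_card hsub') (hA q)
      · refine le_trans ?_ (Order.add_one_le_of_lt (lt_of_le_of_ne (hA q) hq))
        exact_mod_cast (Finset.card_le_card hsub).trans (Finset.card_insert_le _ _)
  · by_cases hk : k = j
    · subst hk; simpa using hfin k
    · simpa [hk] using hfin k
  · exact ⟨touched_mono hle le_rfl, mem_touched.2 ⟨t, by simp, htp⟩⟩

theorem HeightBounded.exists_saturate {A : ι → Set R} (hA : HeightBounded A)
    (hfin : ∀ j, (A j).Finite) {p : PrimeSpectrum R}
    (hp : (Fintype.card ι : ℕ∞) ≤ p.asIdeal.height + 1) :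
    ∃ A' : ι → Set R, A ≤ A' ∧ HeightBounded A' ∧ (∀ j, (A' j).Finite) ∧
      (p.asIdeal.height ≤ (touched A' p).card ∨ touched A' p = Finset.univ) := by
  classical
  induction hn : (touched A p)ᶜ.card using Nat.strong_induction_on generalizing A with
  | _ n ih =>
    by_cases hlt : ((touched A p).card : ℕ∞) < p.asIdeal.height
    swap
    · exact ⟨A, le_rfl, hA, hfin, Or.inl (not_lt.1 hlt)⟩
    by_cases huniv : touched A p = Finset.univ
    · exact ⟨A, le_rfl, hA, hfin, Or.inr huniv⟩
    obtain ⟨j, hj⟩ : ∃ j, j ∉ touched A p := by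
      by_contra! h
      exact huniv (Finset.eq_univ_of_forall h)
    obtain ⟨A₁, h1, h2, h3, h4, h5⟩ := hA.exists_insert hfin hp hlt hj
    obtain ⟨A₂, h6, h7⟩ := ih _ (by
      rw [← hn]
      refine Finset.card_lt_card (Finset.compl_ssubset_compl.2 ?_)
      exact (Finset.ssubset_iff_of_subset h4).2 ⟨j, h5, hj⟩) h2 h3 rfl
    exact ⟨A₂, h1.trans h6, h7⟩

theorem exists_heightBounded_saturated [Countable (PrimeSpectrum R)] (ι : Type*) [Fintype ι] :
    ∃ A : ι → Set R, (∀ j, (A j).Countable) ∧ HeightBounded A ∧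
      ∀ p : PrimeSpectrum R, (Fintype.card ι : ℕ∞) ≤ p.asIdeal.height + 1 →
        p.asIdeal.height ≤ (touched A p).card ∨ touched A p = Finset.univ := by
  classical
  cases isEmpty_or_nonempty (PrimeSpectrum R) with
  | inl h => exact ⟨fun _ => ∅, by simp, fun p => h.elim p, fun p => h.elim p⟩
  | inr h =>
  obtain ⟨P, hP⟩ := exists_surjective_nat (PrimeSpectrum R)
  let T := {A : ι → Set R // HeightBounded A ∧ ∀ j, (A j).Finite}
  have step : ∀ (A : T) (p : PrimeSpectrum R), ∃ A' : T, A.1 ≤ A'.1 ∧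
      ((Fintype.card ι : ℕ∞) ≤ p.asIdeal.height + 1 →
        p.asIdeal.height ≤ (touched A'.1 p).card ∨ touched A'.1 p = Finset.univ) := by
    intro A p
    by_cases hp : (Fintype.card ι : ℕ∞) ≤ p.asIdeal.height + 1
    · obtain ⟨A', h1, h2, h3, h4⟩ := A.2.1.exists_saturate A.2.2 hp
      exact ⟨⟨A', h2, h3⟩, h1, fun _ => h4⟩
    · exact ⟨A, le_rfl, fun h => absurd h hp⟩
  choose next hle hnext using step
  let A₀ : T := ⟨fun _ => ∅, fun p => by
    have : touched (fun _ : ι => (∅ : Set R)) p = ∅ := by ext; simp [mem_touched]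
    simp [this], by simp⟩
  let A : ℕ → T := fun n => Nat.rec A₀ (fun n B => next B (P n)) n
  have hA : Monotone fun n => (A n).1 := monotone_nat_of_le_succ fun n => hle (A n) (P n)
  have hleA : ∀ n, (A n).1 ≤ fun j => ⋃ n, (A n).1 j := fun n j =>
    Set.subset_iUnion (fun n => (A n).1 j) n
  refine ⟨fun j => ⋃ n, (A n).1 j, fun j => Set.countable_iUnion fun n => ((A n).2.2 j).countable,
    fun p => ?_, fun p hp => ?_⟩
  -- The index set being finite, all sets of the union met by `p` are already met at one finite
  -- stage, where the bound holds.
  · obtain ⟨n, hn⟩ : ∃ n, touched (fun j => ⋃ n, (A n).1 j) p ⊆ touched (A n).1 p := by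
      have : ∀ j : ι, ∃ n, j ∈ touched (fun j => ⋃ n, (A n).1 j) p → j ∈ touched (A n).1 p := by
        intro j
        by_cases hj : j ∈ touched (fun j => ⋃ n, (A n).1 j) p
        · obtain ⟨a, ha, hap⟩ := mem_touched.1 hj
          obtain ⟨n, hn⟩ := Set.mem_iUnion.1 ha
          exact ⟨n, fun _ => mem_touched.2 ⟨a, hn, hap⟩⟩
        · exact ⟨0, fun h => absurd h hj⟩
      choose N hN using this
      exact ⟨Finset.univ.sup N, fun j hj =>
        touched_mono (hA (Finset.le_sup (Finset.mem_univ j))) le_rfl (hN j hj)⟩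
    exact le_trans (by exact_mod_cast Finset.card_le_card hn) ((A n).2.1 p)
  · obtain ⟨n, rfl⟩ := hP p
    have hsub := touched_mono (hleA (n + 1)) (le_refl (P n))
    rcases hnext (A n) (P n) hp with h | h
    · exact Or.inl (h.trans (by exact_mod_cast Finset.card_le_card hsub))
    · exact Or.inr (Finset.univ_subset_iff.1 (h ▸ hsub))

/-- The submonoid `S` meets `q`, but not `p`. -/
def Separates (S : Submonoid R) (p q : Ideal R) : Prop :=
  (∃ s ∈ S, s ∈ q) ∧ ∀ s ∈ S, s ∉ p

/-- The hypotheses leave only the heights `e - 1` and `e` for `q`. Then `q` meets as many sets as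
its height while `p` meets fewer, so some set meets `q` alone; the submonoid it generates still
avoids the prime `p`. -/
theorem exists_separating_of_height [Countable (PrimeSpectrum R)] (e : ℕ) :
    ∃ L : List (Submonoid R), L.length = e ∧ (∀ S ∈ L, (S : Set R).Countable) ∧
      ∀ p q : PrimeSpectrum R, p < q → (e : ℕ∞) ≤ q.asIdeal.height + 1 → q.asIdeal.height ≤ e →
        ∃ S ∈ L, Separates S p.asIdeal q.asIdeal := by
  obtain ⟨A, hA, hb, hs⟩ := exists_heightBounded_saturated (R := R) (Fin e)
  refine ⟨List.ofFn fun j => Submonoid.closure (A j), by simp, ?_, fun p q hpq h1 h2 => ?_⟩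
  · simp only [List.mem_ofFn, forall_exists_index, forall_apply_eq_imp_iff]
    intro j
    exact countable_closure (hA j)
  have hlt : p.asIdeal.height < q.asIdeal.height :=
    Ideal.height_strict_mono_of_isPrime_of_isPrime hpq
  have hq : q.asIdeal.height ≤ (touched A q).card := by
    rcases hs q (by simpa using h1) with h | h
    · exact h
    · simpa [h] using h2
  have hcard : (touched A p).card < (touched A q).card := by
    exact_mod_cast (hb p).trans_lt (hlt.trans_le hq)
  obtain ⟨j, hjq, hjp⟩ := Finset.exists_mem_notMem_of_card_lt_card hcard
  refine ⟨_, List.mem_ofFn.2 ⟨j, rfl⟩, ?_, fun s hs hsp => ?_⟩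
  · obtain ⟨a, ha, haq⟩ := mem_touched.1 hjq
    exact ⟨a, Submonoid.subset_closure ha, haq⟩
  · have : Submonoid.closure (A j) ≤ p.asIdeal.primeCompl :=
      Submonoid.closure_le.2 fun a ha hap => hjp (mem_touched.2 ⟨a, ha, hap⟩)
    exact this hs hsp

theorem mu_add_two (e : ℕ) : mu (e + 2) = (e + 2) + mu e := by
  have : (e + 2) / 2 + 1 = (e / 2 + 1) + 1 := by omega
  rw [mu, mu, this, Finset.sum_range_succ', add_comm]
  congr 1
  exact Finset.sum_congr rfl fun i _ => by omega

/-- A block of `e + 2` sets covers heights `e + 1` and `e + 2`, hence the induction in steps of two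
and the value `mu e`. Height zero needs no set, as no prime lies strictly below. -/
theorem exists_separating [Countable (PrimeSpectrum R)] (e : ℕ) :
    ∃ L : List (Submonoid R), L.length = mu e ∧ (∀ S ∈ L, (S : Set R).Countable) ∧
      ∀ p q : PrimeSpectrum R, p < q → q.asIdeal.height ≤ e →
        ∃ S ∈ L, Separates S p.asIdeal q.asIdeal := by
  induction e using Nat.twoStepInduction with
  | zero =>
    refine ⟨[], by simp [mu], by simp, fun p q hpq h => ?_⟩
    have hlt : p.asIdeal.height < q.asIdeal.height :=
      Ideal.height_strict_mono_of_isPrime_of_isPrime hpq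
    simp at h
    simp [h] at hlt
  | one =>
    obtain ⟨L, h1, h2, h3⟩ := exists_separating_of_height (R := R) 1
    exact ⟨L, by simp [h1, mu], h2, fun p q hpq h => h3 p q hpq (by simp) h⟩
  | more e ih _ =>
    obtain ⟨L, h1, h2, h3⟩ := ih
    obtain ⟨L', h1', h2', h3'⟩ := exists_separating_of_height (R := R) (e + 2)
    refine ⟨L' ++ L, by simp [h1, h1', mu_add_two], fun S hS => ?_, fun p q hpq h => ?_⟩
    · rcases List.mem_append.1 hS with h | h
      · exact h2' S h
      · exact h2 S h
    · by_cases hq : q.asIdeal.height ≤ e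
      · obtain ⟨S, hS, h⟩ := h3 p q hpq hq
        exact ⟨S, List.mem_append_right _ hS, h⟩
      · have : ((e + 2 : ℕ) : ℕ∞) ≤ q.asIdeal.height + 1 := by
          have := Order.add_one_le_of_lt (not_le.1 hq)
          push_cast
          rw [show (e : ℕ∞) + 2 = e + 1 + 1 by ring]
          gcongr
        obtain ⟨S, hS, h⟩ := h3' p q hpq this h
        exact ⟨S, List.mem_append_left _ hS, h⟩

end Separation

/-! ### The family `S^×`: countability and joins. -/

theorem timesFamily_countable {R : Type u} [CommRing R] {ι : Type*} [Countable ι]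
    {S : ι → Submonoid R} (hS : ∀ j, (S j : Set R).Countable) (J : Set ι) :
    (timesFamily S J : Set R).Countable := by
  have : timesFamily S J = Submonoid.closure (⋃ j ∈ J, (S j : Set R)) := by
    simp only [timesFamily, Submonoid.closure_iUnion, Submonoid.closure_eq]
  rw [this]
  exact countable_closure (Set.Countable.biUnion J.to_countable fun j _ => hS j)

theorem timesFamily_union {R : Type u} [CommRing R] {ι : Type*} (S : ι → Submonoid R)
    (J J' : Set ι) : timesFamily S (J ∪ J') = timesFamily S J ⊔ timesFamily S J' :=
  iSup_union

theorem timesFamily_singleton {R : Type u} [CommRing R] {ι : Type*} (S : ι → Submonoid R)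
    (j : ι) : timesFamily S {j} = S j :=
  iSup_singleton

end StronglyFlat

theorem mainTheorem5 (R : Type u) [CommRing R] [IsNoetherianRing R]
    [Countable (PrimeSpectrum R)] (d : ℕ) (hd : ringKrullDim R = d) :
    ∃ S : Fin (StronglyFlat.mu d) → Submonoid R,
      (∀ j, (S j : Set R).Countable) ∧
      ∀ (F : Type u) [AddCommGroup F] [Module R F], Module.Flat R F →
        StronglyFlat.IsStronglyFlat (StronglyFlat.timesFamily S) F := by
  obtain ⟨L, hL, hc, hsep⟩ := StronglyFlat.exists_separating (R := R) d
  let S : Fin (StronglyFlat.mu d) → Submonoid R := fun j => L.get (j.cast hL.symm)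
  have hS : ∀ j, (S j : Set R).Countable := fun j => hc _ (L.get_mem _)
  refine ⟨S, hS, fun F _ _ hF C _ _ hC => ?_⟩
  refine StronglyFlat.isCotorsion_of_separatedBy (𝒮 := Set.range (StronglyFlat.timesFamily S))
    ?_ ?_ L ?_ R ?_ C ?_ F hF
  · rintro _ ⟨J, rfl⟩
    exact StronglyFlat.timesFamily_countable hS J
  · rintro _ ⟨J, rfl⟩ _ ⟨J', rfl⟩
    exact ⟨J ∪ J', StronglyFlat.timesFamily_union S J J'⟩
  · intro T hT
    obtain ⟨j, rfl⟩ := List.get_of_mem hT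
    exact ⟨{j.cast hL}, StronglyFlat.timesFamily_singleton S _⟩
  · intro p q hpq
    refine hsep p q hpq ?_
    have := Ideal.height_le_ringKrullDim_of_ne_top q.2.ne_top
    rw [hd] at this
    exact_mod_cast this
  · rintro _ ⟨J, rfl⟩
    exact hC J
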